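/- Let $\varphi(t)=\min_{z\in\mathbb Z}|z-t|$ be the tent map, let $b\ge 2$ be an integer, let $\alpha\in\mathbb R$ with $|\alpha|=1/b$, and let $$f(t)=\sum_{m=0}^\infty\alpha^m\varphi(b^mt),\qquad t\in\mathbb R,$$ be the associated Takagi--van der Waerden function. Set $\Phi(x)=x/\sqrt{-\log x}$ for $x\in(0,1)$ and $\Phi(0)=0$. Then, for every $t\in[0,1]$, the $\Phi$-variation of $f$ along the $b$-adic partitions, $$\langle f\rangle^\Phi_t:=\lim_{n\to\infty}\sum_{k=0}^{\lfloor tb^n\rfloor}\Phi\big(|f((k+1)b^{-n})-f(kb^{-n})|\big),$$ exists (in particular, for all sufficiently large $n$ the increments in the sum are less than $1$, so that $\Phi$ is defined at them), and its value is as follows. If $b$ is even, then $$\langle f\rangle^\Phi_t=t\cdot\sqrt{\frac{2}{\pi\log b}}\qquad\text{for all }t\in[0,1].$$ If $b$ is odd, then $$\langle f\rangle^\Phi_t=t\cdot\sqrt{\frac{2(b+\operatorname{sgn}\alpha)}{\pi(b-\operatorname{sgn}\alpha)\log b}}\qquad\text{for all }t\in[0,1].$$ -/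

import Mathlib

open Filter Topology

noncomputable section

/-- The tent map: the distance from `t` to the nearest integer. -/
def tentMap (t : ℝ) : ℝ := |t - round t|

/-- `tentMap t` is the minimum over all integers `z` of `|z - t|`. -/
theorem tentMap_isLeast (t : ℝ) :
    IsLeast (Set.range fun z : ℤ => |(z : ℝ) - t|) (tentMap t) := by
  refine ⟨⟨round t, abs_sub_comm _ _⟩, ?_⟩
  rintro _ ⟨z, rfl⟩
  simpa only [tentMap, abs_sub_comm (z : ℝ) t] using round_le t z

/-- The Takagi–van der Waerden function `t ↦ ∑_{m ≥ 0} α ^ m φ(b ^ m t)`, `φ` the tent map.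
The series makes sense for every real `t`, with period `1` in `t`. -/
def takagiVdW (b : ℕ) (α : ℝ) (t : ℝ) : ℝ := ∑' m : ℕ, α ^ m * tentMap ((b : ℝ) ^ m * t)

/-- For `|α| < 1` the series defining `takagiVdW b α t` converges. -/
theorem takagiVdW_summable (b : ℕ) {α : ℝ} (hα : |α| < 1) (t : ℝ) :
    Summable fun m : ℕ => α ^ m * tentMap ((b : ℝ) ^ m * t) := by
  refine Summable.of_norm_bounded (summable_geometric_of_lt_one (abs_nonneg α) hα) fun m => ?_
  have h1 : |tentMap ((b : ℝ) ^ m * t)| ≤ 1 := by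
    rw [tentMap, abs_abs]
    exact (abs_sub_round _).trans (by norm_num)
  rw [Real.norm_eq_abs, abs_mul, abs_pow]
  exact mul_le_of_le_one_right (by positivity) h1

/-- The gauge function `Φ(x) = x / √(-log x)` for `0 < x < 1`, and `Φ(0) = 0`.
It is only ever applied to arguments in `[0, 1)`. -/
def criticalPhi (x : ℝ) : ℝ := if x = 0 then 0 else x / √(-Real.log x)

/-- The absolute increment of `f` over `[k b⁻ⁿ, (k + 1) b⁻ⁿ]`. -/
def adicIncrement (b : ℕ) (f : ℝ → ℝ) (n k : ℕ) : ℝ :=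
  |f (((k : ℝ) + 1) / (b : ℝ) ^ n) - f ((k : ℝ) / (b : ℝ) ^ n)|

/-- The `Φ`-variation of `f` on `[0, t]` along the `b`-adic partitions, for a gauge `Φ` with domain
`[0, 1)`, exists and equals `L`: for all large `n` the increments occurring in the `n`-th sum lie in
the domain of `Φ`, and the sums of `Φ(|f((k + 1) b⁻ⁿ) - f(k b⁻ⁿ)|)` over `0 ≤ k ≤ ⌊t bⁿ⌋` converge
to `L`. -/
def HasPhiVariation (Φ : ℝ → ℝ) (b : ℕ) (f : ℝ → ℝ) (t L : ℝ) : Prop :=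
  (∀ᶠ n : ℕ in atTop, ∀ k ∈ Finset.range (⌊t * (b : ℝ) ^ n⌋₊ + 1), adicIncrement b f n k < 1) ∧
    Tendsto (fun n : ℕ => ∑ k ∈ Finset.range (⌊t * (b : ℝ) ^ n⌋₊ + 1), Φ (adicIncrement b f n k))
      atTop (𝓝 L)

end

/-! Write `α = σ / b` with `σ = ±1`. On a `b`-adic interval of level `n` with index `k`, every
surviving term of the series contributes an increment of size `b⁻ⁿ` or `0`, so the increment of `f`
is, up to sign, `S_n(k) / bⁿ` for an integer walk `S_n` with steps in `{-1, 0, 1}`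
(`adicIncrement_takagiVdW`).

Let `k` be uniform on `{0, …, bⁿ - 1}`. The sign at level `m + 1` is decided by the digit of `b ^
m`, unless that digit is the middle one, possible only for odd `b`, when the sign of level `m` is
copied (`adicSign_succ`). Hence the steps form a Markov chain with lag-one correlation `ρ = κσ`,
where `κ` is `0` or `1 / b`. A bounded correction turns `S` into a martingale, and a characteristic
function estimate gives a central limit theorem with variance `v = (1 + ρ) / (1 - ρ)`. Bounded
second moments upgrade this to `E|S_n| / √n → √(2v/π)`.

A nonzero `|S_n|` lies in `[1, n]`, so `-log(|S_n| / bⁿ)` is `n log b` up to `log n`. Thus the full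
`Φ`-sum is asymptotic to `E|S_n| / √(n log b)`. Fixing the `p` leading digits changes `S_n` by
`O(p)`, so each interval of length `b⁻ᵖ` gets its proportional share, and monotonicity of the sums
gives the factor `t`. -/

/-! ### Increments as values of a walk of signs -/

/-- The sign of `b ^ j - 1 - 2 (k mod b ^ j)`: it tells whether the `j`-th level interval with index
`k` lies to the left of, around, or to the right of a half-integer. -/
def adicSign (b j k : ℕ) : ℤ := Int.sign ((b : ℤ) ^ j - 1 - 2 * ((k % b ^ j : ℕ) : ℤ))

/-- The walk with steps `σ ^ j * adicSign b j k`, `1 ≤ j ≤ n`. -/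
noncomputable def signWalk (b : ℕ) (σ : ℝ) (n k : ℕ) : ℝ :=
  ∑ j ∈ Finset.range n, σ ^ (j + 1) * (adicSign b (j + 1) k : ℝ)

theorem tentMap_int (z : ℤ) : tentMap z = 0 := by
  simp [tentMap]

theorem tentMap_add_nat (t : ℝ) (n : ℕ) : tentMap (t + n) = tentMap t := by
  simp [tentMap]

theorem tentMap_eq_min {t : ℝ} (h0 : 0 ≤ t) (h1 : t ≤ 1) : tentMap t = min t (1 - t) := by
  rcases h1.lt_or_eq with h1 | rfl
  · rw [tentMap, abs_sub_round_eq_min, Int.fract_eq_self.2 ⟨h0, h1⟩]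
  · simpa using tentMap_int 1

theorem tentMap_natCast_div {N : ℕ} (hN : 0 < N) (q : ℕ) {x : ℕ} (hx : x ≤ N) :
    tentMap (((q * N + x : ℕ) : ℝ) / N) = min (x : ℝ) (N - x) / N := by
  have hN' : (0 : ℝ) < N := by exact_mod_cast hN
  have hx' : (x : ℝ) ≤ N := by exact_mod_cast hx
  have h : ((q * N + x : ℕ) : ℝ) / N = (x : ℝ) / N + q := by
    push_cast; field_simp; ring
  rw [h, tentMap_add_nat, tentMap_eq_min (by positivity) ((div_le_one hN').2 hx'),
    ← min_div_div_right hN'.le]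
  congr 1
  field_simp

/-- The tent map has slopes `±1` with kinks at multiples of `1/2`. A grid interval straddles a kink
only when `N` is odd and it is centred at a half-integer; the increment then cancels by symmetry. -/
theorem tentMap_increment {N : ℕ} (hN : 0 < N) (k : ℕ) :
    tentMap (((k : ℝ) + 1) / N) - tentMap ((k : ℝ) / N) =
      (Int.sign ((N : ℤ) - 1 - 2 * ((k % N : ℕ) : ℤ)) : ℝ) / N := by
  have hx : k % N < N := Nat.mod_lt _ hN
  obtain ⟨x, hxk⟩ : ∃ x, x = k % N := ⟨_, rfl⟩
  rw [← hxk] at hx ⊢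
  have hk : k = k / N * N + x := by rw [hxk]; exact (Nat.div_add_mod' k N).symm
  have e1 : (k : ℝ) + 1 = ((k / N * N + (x + 1) : ℕ) : ℝ) := by
    rw [← add_assoc, ← hk]; push_cast; ring
  have e2 : (k : ℝ) = ((k / N * N + x : ℕ) : ℝ) := by rw [← hk]
  rw [e1, tentMap_natCast_div hN _ hx, e2, tentMap_natCast_div hN _ hx.le, ← sub_div]
  congr 1
  rcases lt_trichotomy ((N : ℤ) - 1 - 2 * (x : ℤ)) 0 with h | h | h
  · rw [Int.sign_eq_neg_one_of_neg h]
    have h' : (N : ℝ) ≤ 2 * x := by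
      have : N ≤ 2 * x := by omega
      exact_mod_cast this
    push_cast
    rw [min_eq_right (by linarith), min_eq_right (by linarith)]; ring
  · rw [h]
    have h' : (N : ℝ) = 2 * x + 1 := by
      have : N = 2 * x + 1 := by omega
      exact_mod_cast this
    push_cast
    rw [min_eq_right (by linarith), min_eq_left (by linarith), h']; simp; ring
  · rw [Int.sign_eq_one_of_pos h]
    have h' : 2 * (x : ℝ) + 2 ≤ N := by
      have : 2 * x + 2 ≤ N := by omega
      exact_mod_cast this
    push_cast
    rw [min_eq_left (by linarith), min_eq_left (by linarith)]; ring

theorem tentMap_increment_pow {b : ℕ} (hb : 0 < b) (j k : ℕ) :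
    tentMap (((k : ℝ) + 1) / (b : ℝ) ^ j) - tentMap ((k : ℝ) / (b : ℝ) ^ j) =
      (adicSign b j k : ℝ) / (b : ℝ) ^ j := by
  have h := tentMap_increment (pow_pos hb j) k
  push_cast at h
  rw [h, adicSign]
  push_cast
  rfl

/-- Terms with `m ≥ n` evaluate the tent map at integers. The rest are summed in reverse, so that
index `j` belongs to the modulus `b ^ (j + 1)`. -/
theorem takagiVdW_adic {b : ℕ} (hb : 0 < b) (α : ℝ) (n k : ℕ) :
    takagiVdW b α ((k : ℝ) / (b : ℝ) ^ n) =
      ∑ j ∈ Finset.range n, α ^ (n - 1 - j) * tentMap ((k : ℝ) / (b : ℝ) ^ (j + 1)) := by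
  have hb' : (b : ℝ) ≠ 0 := by exact_mod_cast hb.ne'
  rw [takagiVdW, tsum_eq_sum (s := Finset.range n), ← Finset.sum_range_reflect]
  · refine Finset.sum_congr rfl fun j hj => ?_
    have hj := Finset.mem_range.1 hj
    congr 2
    have : (b : ℝ) ^ n = (b : ℝ) ^ (n - 1 - j) * (b : ℝ) ^ (j + 1) := by
      rw [← pow_add]; congr 1; omega
    rw [this]
    field_simp
  · intro m hm
    have hm : n ≤ m := by simpa using hm
    obtain ⟨i, rfl⟩ := Nat.exists_eq_add_of_le hm
    have : (b : ℝ) ^ (n + i) * ((k : ℝ) / (b : ℝ) ^ n) = (((b ^ i * k : ℕ) : ℤ) : ℝ) := by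
      push_cast
      rw [pow_add]; field_simp
    rw [this, tentMap_int, mul_zero]

theorem adicIncrement_takagiVdW {b : ℕ} (hb : 0 < b) {σ : ℝ} (hσ : σ ^ 2 = 1) (n k : ℕ) :
    adicIncrement b (takagiVdW b (σ / b)) n k = |signWalk b σ n k| / (b : ℝ) ^ n := by
  have hb' : (0 : ℝ) < b := by exact_mod_cast hb
  have habs : |σ| = 1 := by
    rw [← sq_eq_sq₀ (abs_nonneg _) zero_le_one, sq_abs, hσ, one_pow]
  have h := takagiVdW_adic hb (σ / b) n (k + 1)
  push_cast at h
  rw [adicIncrement, h, takagiVdW_adic hb, ← Finset.sum_sub_distrib]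
  have key : ∀ j ∈ Finset.range n,
      (σ / b) ^ (n - 1 - j) * tentMap (((k : ℝ) + 1) / (b : ℝ) ^ (j + 1)) -
        (σ / b) ^ (n - 1 - j) * tentMap ((k : ℝ) / (b : ℝ) ^ (j + 1)) =
      σ ^ n / (b : ℝ) ^ n * (σ ^ (j + 1) * (adicSign b (j + 1) k : ℝ)) := by
    intro j hj
    have hj := Finset.mem_range.1 hj
    rw [← mul_sub, tentMap_increment_pow hb]
    have e1 : (b : ℝ) ^ n = (b : ℝ) ^ (n - 1 - j) * (b : ℝ) ^ (j + 1) := by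
      rw [← pow_add]; congr 1; omega
    -- The two exponents have the same parity, so the common sign `σ ^ n` can be pulled out of the
    -- sum.
    have e2 : σ ^ n * σ ^ (j + 1) = σ ^ (n - 1 - j) := by
      have : n + (j + 1) = (n - 1 - j) + 2 * (j + 1) := by omega
      rw [← pow_add, this, pow_add, pow_mul, hσ, one_pow, mul_one]
    calc _ = σ ^ (n - 1 - j) * (adicSign b (j + 1) k : ℝ) / (b : ℝ) ^ n := by
          rw [e1, div_pow]; field_simp
      _ = _ := by rw [← e2]; ring
  rw [Finset.sum_congr rfl key, ← Finset.mul_sum, abs_mul, abs_div, abs_pow, habs, one_pow,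
    abs_of_pos (pow_pos hb' n), signWalk]
  ring

theorem abs_adicSign_le (b j k : ℕ) : |(adicSign b j k : ℝ)| ≤ 1 := by
  rw [adicSign]
  rcases Int.sign_trichotomy ((b : ℤ) ^ j - 1 - 2 * ((k % b ^ j : ℕ) : ℤ)) with h | h | h <;>
    rw [h] <;> simp

theorem signWalk_add (b : ℕ) (σ : ℝ) (m p k : ℕ) : signWalk b σ (m + p) k =
    signWalk b σ m k +
      ∑ j ∈ Finset.range p, σ ^ (m + j + 1) * (adicSign b (m + j + 1) k : ℝ) :=
  Finset.sum_range_add _ _ _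

theorem abs_signWalk_add_sub_le (b : ℕ) {σ : ℝ} (hσ : |σ| = 1) (m p k : ℕ) :
    |signWalk b σ (m + p) k - signWalk b σ m k| ≤ p := by
  rw [signWalk_add, add_sub_cancel_left]
  refine (Finset.abs_sum_le_sum_abs _ _).trans ?_
  calc _ ≤ ∑ _j ∈ Finset.range p, (1 : ℝ) := by
        refine Finset.sum_le_sum fun j _ => ?_
        rw [abs_mul, abs_pow, hσ, one_pow, one_mul]
        exact abs_adicSign_le _ _ _
    _ = p := by simp

theorem abs_signWalk_le (b : ℕ) {σ : ℝ} (hσ : |σ| = 1) (n k : ℕ) : |signWalk b σ n k| ≤ n := by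
  simpa [signWalk] using abs_signWalk_add_sub_le b hσ 0 n k

theorem adicSign_mul_pow_add (b : ℕ) {j m : ℕ} (hj : j ≤ m) (a r : ℕ) :
    adicSign b j (a * b ^ m + r) = adicSign b j r := by
  obtain ⟨i, rfl⟩ := Nat.exists_eq_add_of_le hj
  have : (a * b ^ (j + i) + r) % b ^ j = r % b ^ j := by
    rw [pow_add, mul_comm (b ^ j), ← mul_assoc, Nat.mul_add_mod_self_right]
  rw [adicSign, adicSign, this]

theorem signWalk_mul_pow_add (b : ℕ) (σ : ℝ) (m a r : ℕ) :
    signWalk b σ m (a * b ^ m + r) = signWalk b σ m r :=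
  Finset.sum_congr rfl fun j hj => by
    rw [adicSign_mul_pow_add b (Nat.succ_le_of_lt (Finset.mem_range.1 hj))]

/-- Integrality keeps a nonzero walk at distance at least `1` from zero, which controls the
logarithm in the gauge. -/
theorem exists_int_signWalk (b : ℕ) {σ : ℝ} (hσ : σ = 1 ∨ σ = -1) (n k : ℕ) :
    ∃ z : ℤ, signWalk b σ n k = z := by
  rcases hσ with rfl | rfl
  · exact ⟨∑ j ∈ Finset.range n, 1 ^ (j + 1) * adicSign b (j + 1) k, by
      rw [signWalk]; push_cast; rfl⟩
  · exact ⟨∑ j ∈ Finset.range n, (-1) ^ (j + 1) * adicSign b (j + 1) k, by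
      rw [signWalk]; push_cast; rfl⟩

/-! ### Uniform averages -/

/-- The average of `F` over `{0, …, N - 1}`. -/
noncomputable def rangeAvg {E : Type*} [AddCommGroup E] [Module ℝ E] (N : ℕ) (F : ℕ → E) : E :=
  (N : ℝ)⁻¹ • ∑ k ∈ Finset.range N, F k

section rangeAvg

variable {E : Type*} [AddCommGroup E] [Module ℝ E]

theorem rangeAvg_congr {N : ℕ} {F G : ℕ → E} (h : ∀ k < N, F k = G k) :
    rangeAvg N F = rangeAvg N G := by
  rw [rangeAvg, rangeAvg, Finset.sum_congr rfl fun k hk => h k (Finset.mem_range.1 hk)]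

theorem rangeAvg_add (N : ℕ) (F G : ℕ → E) :
    rangeAvg N (fun k => F k + G k) = rangeAvg N F + rangeAvg N G := by
  simp [rangeAvg, Finset.sum_add_distrib, smul_add]

theorem rangeAvg_sub (N : ℕ) (F G : ℕ → E) :
    rangeAvg N (fun k => F k - G k) = rangeAvg N F - rangeAvg N G := by
  simp [rangeAvg, Finset.sum_sub_distrib, smul_sub]

theorem rangeAvg_const {N : ℕ} (hN : 0 < N) (c : E) : rangeAvg N (fun _ => c) = c := by
  have : (N : ℝ) ≠ 0 := by exact_mod_cast hN.ne'
  rw [rangeAvg, Finset.sum_const, Finset.card_range, ← Nat.cast_smul_eq_nsmul ℝ, smul_smul,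
    inv_mul_cancel₀ this, one_smul]

theorem rangeAvg_mul_left {A : Type*} [Ring A] [Algebra ℝ A] (N : ℕ) (c : A) (F : ℕ → A) :
    rangeAvg N (fun k => c * F k) = c * rangeAvg N F := by
  simp [rangeAvg, ← Finset.mul_sum]

theorem rangeAvg_mono {N : ℕ} {F G : ℕ → ℝ} (h : ∀ k < N, F k ≤ G k) :
    rangeAvg N F ≤ rangeAvg N G :=
  smul_le_smul_of_nonneg_left (Finset.sum_le_sum fun k hk => h k (Finset.mem_range.1 hk))
    (by positivity)

theorem norm_rangeAvg_le {V : Type*} [NormedAddCommGroup V] [NormedSpace ℝ V] (N : ℕ)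
    (F : ℕ → V) : ‖rangeAvg N F‖ ≤ rangeAvg N fun k => ‖F k‖ := by
  rw [rangeAvg, rangeAvg, norm_smul, Real.norm_of_nonneg (by positivity), smul_eq_mul]
  exact mul_le_mul_of_nonneg_left (norm_sum_le _ _) (by positivity)

theorem sum_range_mul_eq {M : Type*} [AddCommMonoid M] (d N : ℕ) (F : ℕ → M) :
    ∑ k ∈ Finset.range (d * N), F k =
      ∑ i ∈ Finset.range d, ∑ r ∈ Finset.range N, F (i * N + r) := by
  induction d with
  | zero => simp
  | succ d ih => rw [Nat.succ_mul, Finset.sum_range_add, ih, Finset.sum_range_succ]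

/-- Conditioning: average over the leading digit `i` with the lower part `r` fixed, then over `r`.
-/
theorem rangeAvg_mul (d N : ℕ) (F : ℕ → E) :
    rangeAvg (d * N) F = rangeAvg N fun r => rangeAvg d fun i => F (i * N + r) := by
  simp only [rangeAvg]
  rw [sum_range_mul_eq, Finset.sum_comm, ← Finset.smul_sum, smul_smul, Nat.cast_mul, mul_inv,
    mul_comm]

end rangeAvg

/-! ### Markov structure of the steps -/

theorem adicSign_zero (b k : ℕ) : adicSign b 0 k = 0 := by
  simp [adicSign, Nat.mod_one]

/-- The term `(b - 1 - 2d) b ^ m` dominates the lower-order part unless it vanishes, that is, unless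
`d` is the middle digit. -/
theorem adicSign_succ {b m d r : ℕ} (hd : d < b) (hr : r < b ^ m) :
    adicSign b (m + 1) (d * b ^ m + r) =
      if 2 * d + 1 < b then 1 else if 2 * d + 1 = b then adicSign b m r else -1 := by
  have hlt : d * b ^ m + r < b ^ (m + 1) := by
    calc d * b ^ m + r < (d + 1) * b ^ m := by rw [add_mul, one_mul]; omega
      _ ≤ b * b ^ m := Nat.mul_le_mul_right _ hd
      _ = _ := (pow_succ' b m).symm
  rw [adicSign, adicSign, Nat.mod_eq_of_lt hlt, Nat.mod_eq_of_lt hr]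
  have hr' : (r : ℤ) < (b : ℤ) ^ m := by exact_mod_cast hr
  have hr0 : (0 : ℤ) ≤ r := by positivity
  have e : (b : ℤ) ^ (m + 1) - 1 - 2 * ((d * b ^ m + r : ℕ) : ℤ) =
      ((b : ℤ) - 1 - 2 * d) * (b : ℤ) ^ m + ((b : ℤ) ^ m - 1 - 2 * r) := by
    push_cast; ring
  rw [e]
  split_ifs with h1 h2
  · apply Int.sign_eq_one_of_pos
    have : (1 : ℤ) ≤ (b : ℤ) - 1 - 2 * d := by omega
    nlinarith
  · have : (b : ℤ) - 1 - 2 * d = 0 := by omega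
    rw [this, zero_mul, zero_add]
  · apply Int.sign_eq_neg_one_of_neg
    have : (b : ℤ) - 1 - 2 * d ≤ -1 := by omega
    nlinarith

/-- The `m`-th step of `signWalk b σ`. -/
noncomputable def walkStep (b : ℕ) (σ : ℝ) (m k : ℕ) : ℝ := σ ^ m * (adicSign b m k : ℝ)

theorem signWalk_succ (b : ℕ) (σ : ℝ) (m k : ℕ) :
    signWalk b σ (m + 1) k = signWalk b σ m k + walkStep b σ (m + 1) k :=
  Finset.sum_range_succ _ _

/-- Low and high digits are equally many, so the factor `σ ^ (m + 1)` only swaps their roles; a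
middle digit repeats the previous step times `σ`. -/
theorem sum_walkStep_succ {E : Type*} [AddCommMonoid E] {b : ℕ} {σ : ℝ}
    (hσ : σ = 1 ∨ σ = -1) {m r : ℕ} (hr : r < b ^ m) (F : ℝ → E) :
    ∑ d ∈ Finset.range b, F (walkStep b σ (m + 1) (d * b ^ m + r)) =
      (b / 2) • (F 1 + F (-1)) + (b % 2) • F (σ * walkStep b σ m r) := by
  have hpow : F (σ ^ (m + 1)) + F (-σ ^ (m + 1)) = F 1 + F (-1) := by
    have : σ ^ (m + 1) = 1 ∨ σ ^ (m + 1) = -1 := by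
      rcases hσ with rfl | rfl
      · simp
      · exact neg_one_pow_eq_or ℝ (m + 1)
    rcases this with h | h <;> rw [h]
    rw [neg_neg, add_comm]
  have hsum : ∀ d ∈ Finset.range b, F (walkStep b σ (m + 1) (d * b ^ m + r)) =
      if 2 * d + 1 < b then F (σ ^ (m + 1)) else
        if 2 * d + 1 = b then F (σ * walkStep b σ m r) else F (-σ ^ (m + 1)) := by
    intro d hd
    rw [walkStep, adicSign_succ (Finset.mem_range.1 hd) hr]
    split_ifs
    · simp
    · rw [walkStep, pow_succ', mul_assoc]
    · simp
  rw [Finset.sum_congr rfl hsum, ← hpow]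
  generalize F (σ ^ (m + 1)) = A
  generalize F (-σ ^ (m + 1)) = B
  generalize F (σ * walkStep b σ m r) = C
  obtain ⟨h, hh⟩ : ∃ h, h = b / 2 := ⟨_, rfl⟩
  -- Digits split into a low half, at most one middle digit and a high half.
  have hb : b = h + b % 2 + h := by omega
  have hlow : ∑ d ∈ Finset.range h, (if 2 * d + 1 < b then A else if 2 * d + 1 = b then C else B) =
      h • A := by
    rw [Finset.sum_congr rfl fun d hd => if_pos (by have := Finset.mem_range.1 hd; omega)]
    simp
  have hhigh : ∑ d ∈ Finset.range h, (if 2 * (h + b % 2 + d) + 1 < b then A else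
      if 2 * (h + b % 2 + d) + 1 = b then C else B) = h • B := by
    rw [Finset.sum_congr rfl fun d hd => (if_neg (by omega)).trans (if_neg (by omega))]
    simp
  have hmid : ∑ d ∈ Finset.range (b % 2), (if 2 * (h + d) + 1 < b then A else
      if 2 * (h + d) + 1 = b then C else B) = (b % 2) • C := by
    rw [Finset.sum_congr rfl fun d hd => (if_neg (by have := Finset.mem_range.1 hd; omega)).trans
      (if_pos (by have := Finset.mem_range.1 hd; omega))]
    simp
  rw [← hh]
  have hsplit : Finset.range b = Finset.range (h + b % 2 + h) := by rw [← hb]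
  rw [hsplit, Finset.sum_range_add, Finset.sum_range_add, hlow, hmid, hhigh, nsmul_add]
  abel

/-- The proportion of digits in base `b` that sit exactly in the middle. -/
noncomputable def midRatio (b : ℕ) : ℝ := ((b % 2 : ℕ) : ℝ) / b

theorem midRatio_nonneg (b : ℕ) : 0 ≤ midRatio b := by
  unfold midRatio; positivity

theorem midRatio_le_half {b : ℕ} (hb : 2 ≤ b) : midRatio b ≤ 1 / 2 := by
  have h1 : ((b % 2 : ℕ) : ℝ) ≤ 1 := by exact_mod_cast (by omega : b % 2 ≤ 1)
  have h2 : (2 : ℝ) ≤ b := by exact_mod_cast hb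
  rw [midRatio, div_le_div_iff₀ (by linarith) (by norm_num)]
  linarith

theorem rangeAvg_walkStep_succ {E : Type*} [AddCommGroup E] [Module ℝ E] {b : ℕ} (hb : 0 < b)
    {σ : ℝ} (hσ : σ = 1 ∨ σ = -1) {m r : ℕ} (hr : r < b ^ m) (F : ℝ → E) :
    rangeAvg b (fun d => F (walkStep b σ (m + 1) (d * b ^ m + r))) =
      ((1 - midRatio b) / 2) • (F 1 + F (-1)) + midRatio b • F (σ * walkStep b σ m r) := by
  have hb' : (b : ℝ) ≠ 0 := by exact_mod_cast hb.ne'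
  rw [rangeAvg, sum_walkStep_succ hσ hr, smul_add, ← Nat.cast_smul_eq_nsmul ℝ,
    ← Nat.cast_smul_eq_nsmul ℝ (b % 2), smul_smul, smul_smul]
  have h : (b : ℝ) = 2 * ((b / 2 : ℕ) : ℝ) + ((b % 2 : ℕ) : ℝ) := by
    exact_mod_cast (Nat.div_add_mod b 2).symm
  congr 2
  · rw [midRatio]
    field_simp
    linarith
  · rw [midRatio]; ring

theorem walkStep_sq_le_one (b : ℕ) {σ : ℝ} (hσ : σ = 1 ∨ σ = -1) (m k : ℕ) :
    walkStep b σ m k ^ 2 ≤ 1 := by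
  have h1 : |walkStep b σ m k| ≤ 1 := by
    have : |σ| = 1 := by rcases hσ with rfl | rfl <;> simp
    rw [walkStep, abs_mul, abs_pow, this, one_pow, one_mul]
    exact abs_adicSign_le _ _ _
  exact (sq_le_one_iff_abs_le_one _).2 h1

/-- The averaged quantity is the indicator of a zero step, which needs all `m` digits to be in the
middle. -/
theorem rangeAvg_one_sub_walkStep_sq {b : ℕ} (hb : 0 < b) {σ : ℝ} (hσ : σ = 1 ∨ σ = -1) (m : ℕ) :
    rangeAvg (b ^ m) (fun k => 1 - walkStep b σ m k ^ 2) = midRatio b ^ m := by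
  have hσ2 : σ ^ 2 = 1 := by rcases hσ with rfl | rfl <;> simp
  induction m with
  | zero => simp [rangeAvg, walkStep, adicSign_zero]
  | succ m ih =>
    rw [pow_succ' b m, rangeAvg_mul, pow_succ', ← ih, ← rangeAvg_mul_left]
    refine rangeAvg_congr fun r hr => ?_
    rw [rangeAvg_walkStep_succ hb hσ hr fun x => 1 - x ^ 2, mul_pow, hσ2]
    simp

/-! ### Martingale approximation -/

/-- The lag-one correlation of the steps of `signWalk b σ`. -/
noncomputable def stepCorr (b : ℕ) (σ : ℝ) : ℝ := midRatio b * σ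

/-- The martingale obtained from `signWalk b σ` by a bounded correction. -/
noncomputable def martWalk (b : ℕ) (σ : ℝ) (m k : ℕ) : ℝ :=
  signWalk b σ m k + ((1 - stepCorr b σ)⁻¹ - 1) * walkStep b σ m k

/-- The asymptotic variance of `signWalk b σ`. -/
noncomputable def walkVar (b : ℕ) (σ : ℝ) : ℝ := (1 + stepCorr b σ) / (1 - stepCorr b σ)

theorem abs_stepCorr_le {b : ℕ} (hb : 2 ≤ b) {σ : ℝ} (hσ : σ = 1 ∨ σ = -1) :
    |stepCorr b σ| ≤ 1 / 2 := by
  have : |σ| = 1 := by rcases hσ with rfl | rfl <;> simp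
  rw [stepCorr, abs_mul, this, mul_one, abs_of_nonneg (midRatio_nonneg b)]
  exact midRatio_le_half hb

theorem stepCorr_lt_one {b : ℕ} (hb : 2 ≤ b) {σ : ℝ} (hσ : σ = 1 ∨ σ = -1) :
    0 < 1 - stepCorr b σ := by
  linarith [(abs_le.1 (abs_stepCorr_le hb hσ)).2]

theorem inv_one_sub_stepCorr_le {b : ℕ} (hb : 2 ≤ b) {σ : ℝ} (hσ : σ = 1 ∨ σ = -1) :
    (1 - stepCorr b σ)⁻¹ ≤ 2 := by
  rw [inv_le_comm₀ (stepCorr_lt_one hb hσ) (by norm_num)]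
  linarith [(abs_le.1 (abs_stepCorr_le hb hσ)).2]

theorem inv_one_sub_stepCorr_pos {b : ℕ} (hb : 2 ≤ b) {σ : ℝ} (hσ : σ = 1 ∨ σ = -1) :
    0 < (1 - stepCorr b σ)⁻¹ := inv_pos.2 (stepCorr_lt_one hb hσ)

theorem walkVar_nonneg {b : ℕ} (hb : 2 ≤ b) {σ : ℝ} (hσ : σ = 1 ∨ σ = -1) : 0 ≤ walkVar b σ :=
  div_nonneg (by linarith [(abs_le.1 (abs_stepCorr_le hb hσ)).1]) (stepCorr_lt_one hb hσ).le

theorem martWalk_zero (b : ℕ) (σ : ℝ) (k : ℕ) : martWalk b σ 0 k = 0 := by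
  simp [martWalk, signWalk, walkStep, adicSign_zero]

/-- Given the lower digits, the next step has mean `ρ` times the current one, so the bracket is
centred. -/
theorem martWalk_succ {b : ℕ} (hb : 2 ≤ b) {σ : ℝ} (hσ : σ = 1 ∨ σ = -1) (m d r : ℕ) :
    martWalk b σ (m + 1) (d * b ^ m + r) = martWalk b σ m r + (1 - stepCorr b σ)⁻¹ *
      (walkStep b σ (m + 1) (d * b ^ m + r) - stepCorr b σ * walkStep b σ m r) := by
  have h := (stepCorr_lt_one hb hσ).ne'
  rw [martWalk, martWalk, signWalk_succ, signWalk_mul_pow_add]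
  field_simp
  ring

theorem abs_martWalk_sub_signWalk_le {b : ℕ} (hb : 2 ≤ b) {σ : ℝ} (hσ : σ = 1 ∨ σ = -1)
    (m k : ℕ) : |martWalk b σ m k - signWalk b σ m k| ≤ 1 := by
  rw [martWalk, add_sub_cancel_left, abs_mul]
  refine mul_le_one₀ ?_ (abs_nonneg _) ((sq_le_one_iff_abs_le_one _).1 (walkStep_sq_le_one b hσ m k))
  rw [abs_le]
  constructor <;> linarith [inv_one_sub_stepCorr_le hb hσ, inv_one_sub_stepCorr_pos hb hσ]

theorem rangeAvg_martWalk_sq_le {b : ℕ} (hb : 2 ≤ b) {σ : ℝ} (hσ : σ = 1 ∨ σ = -1) (m : ℕ) :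
    rangeAvg (b ^ m) (fun k => martWalk b σ m k ^ 2) ≤ 4 * m := by
  induction m with
  | zero => simp [rangeAvg, martWalk_zero]
  | succ m ih =>
    have hpos : 0 < b ^ m := pow_pos (by omega) m
    rw [pow_succ' b m, rangeAvg_mul]
    calc _ ≤ rangeAvg (b ^ m) (fun k => martWalk b σ m k ^ 2 + 4) := by
          refine rangeAvg_mono fun r hr => ?_
          simp only [martWalk_succ hb hσ]
          rw [rangeAvg_walkStep_succ (by omega) hσ hr fun x =>
            (martWalk b σ m r + (1 - stepCorr b σ)⁻¹ * (x - stepCorr b σ * walkStep b σ m r)) ^ 2]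
          have h1 := walkStep_sq_le_one b hσ m r
          have h2 := inv_one_sub_stepCorr_le hb hσ
          have h3 := inv_one_sub_stepCorr_pos hb hσ
          have h4 := midRatio_nonneg b
          have h5 := midRatio_le_half hb
          have hσ2 : σ ^ 2 = 1 := by rcases hσ with rfl | rfl <;> simp
          have hc : (1 - stepCorr b σ)⁻¹ ^ 2 ≤ 4 := by nlinarith
          generalize (1 - stepCorr b σ)⁻¹ = c at *
          rw [stepCorr]
          generalize midRatio b = κ at *
          generalize walkStep b σ m r = x at *
          generalize martWalk b σ m r = M at *
          simp only [smul_eq_mul]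
          -- The terms linear in `M` cancel, which is the martingale property.
          have e : (1 - κ) / 2 * ((M + c * (1 - κ * σ * x)) ^ 2 + (M + c * (-1 - κ * σ * x)) ^ 2) +
              κ * (M + c * (σ * x - κ * σ * x)) ^ 2 =
              M ^ 2 + c ^ 2 * (1 - κ + κ * x ^ 2 - κ ^ 2 * x ^ 2) := by
            linear_combination (c ^ 2 * κ * x ^ 2 - c ^ 2 * κ ^ 2 * x ^ 2) * hσ2
          rw [e]
          have hx := sq_nonneg x
          have h6 : 1 - κ + κ * x ^ 2 - κ ^ 2 * x ^ 2 ≤ 1 := by nlinarith [sq_nonneg (κ * x)]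
          nlinarith [sq_nonneg c]
      _ = rangeAvg (b ^ m) (fun k => martWalk b σ m k ^ 2) + 4 := by
          rw [rangeAvg_add, rangeAvg_const hpos]
      _ ≤ _ := by push_cast; linarith

/-! ### Central limit theorem by characteristic functions -/

theorem norm_exp_I_mul_sub_le {y : ℝ} (hy : |y| ≤ 1) :
    ‖Complex.exp (y * Complex.I) - (1 + y * Complex.I - (y : ℂ) ^ 2 / 2)‖ ≤ |y| ^ 3 := by
  have hn : ‖(y : ℂ) * Complex.I‖ = |y| := by simp
  have h := Complex.exp_bound (x := (y : ℂ) * Complex.I) (by rw [hn]; exact hy) (n := 3) (by norm_num)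
  rw [hn] at h
  have e : ∑ m ∈ Finset.range 3, ((y : ℂ) * Complex.I) ^ m / (m.factorial : ℂ) =
      1 + y * Complex.I - (y : ℂ) ^ 2 / 2 := by
    simp [Finset.sum_range_succ, mul_pow, Complex.I_sq]
    ring
  rw [e] at h
  refine h.trans (mul_le_of_le_one_right (by positivity) ?_)
  norm_num [Nat.factorial]

/-- Second-order Taylor expansion of the conditional characteristic function. Increments are at most
`2 · 3/2 = 3`, whence `27 = 3³`; the conditional variance equals `walkVar` except after a zero step,
whence the second error term. -/
theorem norm_rangeAvg_exp_step_sub_le {b : ℕ} (hb : 2 ≤ b) {σ : ℝ} (hσ : σ = 1 ∨ σ = -1)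
    {m r : ℕ} (hr : r < b ^ m) {ξ : ℝ} (hξ : 3 * |ξ| ≤ 1) :
    ‖rangeAvg b (fun d => Complex.exp (((ξ * ((1 - stepCorr b σ)⁻¹ *
        (walkStep b σ (m + 1) (d * b ^ m + r) - stepCorr b σ * walkStep b σ m r)) : ℝ) : ℂ) *
          Complex.I)) - ((1 - ξ ^ 2 * walkVar b σ / 2 : ℝ) : ℂ)‖ ≤
      27 * |ξ| ^ 3 + ξ ^ 2 * (1 - walkStep b σ m r ^ 2) := by
  have hb0 : 0 < b := by omega
  obtain ⟨D, hD⟩ : ∃ D : ℝ → ℝ,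
      D = fun x => (1 - stepCorr b σ)⁻¹ * (x - stepCorr b σ * walkStep b σ m r) := ⟨_, rfl⟩
  have h1 := walkStep_sq_le_one b hσ m r
  have h2 := inv_one_sub_stepCorr_le hb hσ
  have h3 := inv_one_sub_stepCorr_pos hb hσ
  have h4 := midRatio_nonneg b
  have h5 := midRatio_le_half hb
  have hρ := abs_stepCorr_le hb hσ
  have hσ2 : σ ^ 2 = 1 := by rcases hσ with rfl | rfl <;> simp
  have hDle : ∀ k, |D (walkStep b σ (m + 1) k)| ≤ 3 := by
    intro k
    have hx1 := (sq_le_one_iff_abs_le_one _).1 (walkStep_sq_le_one b hσ (m + 1) k)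
    have hx2 := (sq_le_one_iff_abs_le_one _).1 h1
    have hp : |stepCorr b σ * walkStep b σ m r| ≤ 1 / 2 := by
      rw [abs_mul]
      nlinarith [abs_nonneg (stepCorr b σ), abs_nonneg (walkStep b σ m r)]
    have hs : |walkStep b σ (m + 1) k - stepCorr b σ * walkStep b σ m r| ≤ 3 / 2 :=
      (abs_sub _ _).trans (by linarith)
    rw [hD, abs_mul, abs_of_pos h3]
    nlinarith [abs_nonneg (walkStep b σ (m + 1) k - stepCorr b σ * walkStep b σ m r)]
  have hquad : rangeAvg b (fun d => (1 + ((ξ * D (walkStep b σ (m + 1) (d * b ^ m + r)) : ℝ) : ℂ) *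
      Complex.I - ((ξ * D (walkStep b σ (m + 1) (d * b ^ m + r)) : ℝ) : ℂ) ^ 2 / 2)) =
      ((1 - ξ ^ 2 * walkVar b σ / 2 : ℝ) : ℂ) + ((ξ ^ 2 / 2 * ((1 - stepCorr b σ)⁻¹ ^ 2 *
        (midRatio b - midRatio b ^ 2) * (1 - walkStep b σ m r ^ 2)) : ℝ) : ℂ) := by
    rw [rangeAvg_walkStep_succ hb0 hσ hr fun x =>
      (1 + ((ξ * D x : ℝ) : ℂ) * Complex.I - ((ξ * D x : ℝ) : ℂ) ^ 2 / 2)]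
    have hv : walkVar b σ = (1 - stepCorr b σ)⁻¹ ^ 2 * (1 - midRatio b ^ 2) := by
      have hne := (stepCorr_lt_one hb hσ).ne'
      have : midRatio b ^ 2 = stepCorr b σ ^ 2 := by rw [stepCorr, mul_pow, hσ2, mul_one]
      rw [walkVar, this]
      field_simp
      ring
    have hκ : ((stepCorr b σ : ℝ) : ℂ) = (midRatio b : ℂ) * σ := by rw [stepCorr]; push_cast; rfl
    have hσC : (σ : ℂ) ^ 2 = 1 := by exact_mod_cast hσ2
    rw [hv, hD]
    generalize (1 - stepCorr b σ)⁻¹ = c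
    simp only [Complex.real_smul]
    push_cast
    rw [hκ]
    generalize (walkStep b σ m r : ℂ) = x
    generalize (midRatio b : ℂ) = κ
    linear_combination (-(ξ : ℂ) ^ 2 * c ^ 2 / 2 * (κ - κ ^ 2) * x ^ 2) * hσC
  have hsplit : rangeAvg b (fun d => Complex.exp (((ξ * D (walkStep b σ (m + 1) (d * b ^ m + r)) :
      ℝ) : ℂ) * Complex.I)) - ((1 - ξ ^ 2 * walkVar b σ / 2 : ℝ) : ℂ) =
      rangeAvg b (fun d => Complex.exp (((ξ * D (walkStep b σ (m + 1) (d * b ^ m + r)) : ℝ) : ℂ) *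
        Complex.I) - (1 + ((ξ * D (walkStep b σ (m + 1) (d * b ^ m + r)) : ℝ) : ℂ) *
        Complex.I - ((ξ * D (walkStep b σ (m + 1) (d * b ^ m + r)) : ℝ) : ℂ) ^ 2 / 2)) +
      ((ξ ^ 2 / 2 * ((1 - stepCorr b σ)⁻¹ ^ 2 *
        (midRatio b - midRatio b ^ 2) * (1 - walkStep b σ m r ^ 2)) : ℝ) : ℂ) := by
    rw [rangeAvg_sub, hquad]; ring
  have hDdef : ∀ k, (1 - stepCorr b σ)⁻¹ *
      (walkStep b σ (m + 1) k - stepCorr b σ * walkStep b σ m r) =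
      D (walkStep b σ (m + 1) k) := fun k => by rw [hD]
  simp only [hDdef]
  rw [hsplit]
  refine (norm_add_le _ _).trans (add_le_add ?_ ?_)
  · refine (norm_rangeAvg_le _ _).trans ?_
    calc _ ≤ rangeAvg b (fun _ => 27 * |ξ| ^ 3) := by
          refine rangeAvg_mono fun d _ => ?_
          have hle : |ξ * D (walkStep b σ (m + 1) (d * b ^ m + r))| ≤ 3 * |ξ| := by
            rw [abs_mul, mul_comm]
            exact mul_le_mul_of_nonneg_right (hDle _) (abs_nonneg _)
          refine (norm_exp_I_mul_sub_le (hle.trans hξ)).trans ?_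
          calc _ ≤ (3 * |ξ|) ^ 3 := pow_le_pow_left₀ (abs_nonneg _) hle 3
            _ = _ := by ring
      _ = _ := rangeAvg_const hb0 _
  · rw [Complex.norm_real, Real.norm_eq_abs]
    have hx : 0 ≤ 1 - walkStep b σ m r ^ 2 := by linarith
    have hκ : 0 ≤ midRatio b - midRatio b ^ 2 := by nlinarith
    have hκ' : midRatio b - midRatio b ^ 2 ≤ 1 / 4 := by nlinarith [sq_nonneg (midRatio b - 1 / 2)]
    have hc : (1 - stepCorr b σ)⁻¹ ^ 2 ≤ 4 := by nlinarith
    have hck : (1 - stepCorr b σ)⁻¹ ^ 2 * (midRatio b - midRatio b ^ 2) ≤ 2 := by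
      nlinarith [sq_nonneg ((1 - stepCorr b σ)⁻¹)]
    rw [abs_of_nonneg (by positivity)]
    calc _ ≤ ξ ^ 2 / 2 * (2 * (1 - walkStep b σ m r ^ 2)) := by gcongr
      _ = _ := by ring

theorem norm_rangeAvg_exp_martWalk_succ_sub_le {b : ℕ} (hb : 2 ≤ b) {σ : ℝ}
    (hσ : σ = 1 ∨ σ = -1) (m : ℕ) {ξ : ℝ} (hξ : 3 * |ξ| ≤ 1) :
    ‖rangeAvg (b ^ (m + 1)) (fun k => Complex.exp (((ξ * martWalk b σ (m + 1) k : ℝ) : ℂ) *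
        Complex.I)) - ((1 - ξ ^ 2 * walkVar b σ / 2 : ℝ) : ℂ) *
      rangeAvg (b ^ m) (fun k => Complex.exp (((ξ * martWalk b σ m k : ℝ) : ℂ) * Complex.I))‖ ≤
      27 * |ξ| ^ 3 + ξ ^ 2 * (1 / 2) ^ m := by
  have hpos : 0 < b ^ m := pow_pos (by omega) m
  rw [pow_succ' b m, rangeAvg_mul, ← rangeAvg_mul_left, ← rangeAvg_sub]
  refine (norm_rangeAvg_le _ _).trans ?_
  calc _ ≤ rangeAvg (b ^ m) (fun r => 27 * |ξ| ^ 3 + ξ ^ 2 * (1 - walkStep b σ m r ^ 2)) := by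
        refine rangeAvg_mono fun r hr => ?_
        refine le_trans (le_of_eq ?_) (norm_rangeAvg_exp_step_sub_le hb hσ hr hξ)
        simp only [martWalk_succ hb hσ, mul_add, Complex.ofReal_add, add_mul, Complex.exp_add]
        rw [rangeAvg_mul_left, mul_comm (((1 - ξ ^ 2 * walkVar b σ / 2 : ℝ) : ℂ)), ← mul_sub,
          norm_mul, Complex.norm_exp_ofReal_mul_I, one_mul]
    _ = 27 * |ξ| ^ 3 + ξ ^ 2 * midRatio b ^ m := by
        rw [rangeAvg_add, rangeAvg_const hpos, rangeAvg_mul_left,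
          rangeAvg_one_sub_walkStep_sq (by omega) hσ]
    _ ≤ _ := by
        gcongr
        · exact midRatio_nonneg b
        · exact midRatio_le_half hb

/-- One-step errors add up because the multiplier has modulus at most one. The zero-step errors form
a geometric series, so with `ξ = u / √m` the total is `O(m^(-1/2))`. -/
theorem norm_rangeAvg_exp_martWalk_sub_pow_le {b : ℕ} (hb : 2 ≤ b) {σ : ℝ}
    (hσ : σ = 1 ∨ σ = -1) {ξ : ℝ} (hξ : 3 * |ξ| ≤ 1)
    (hv : |1 - ξ ^ 2 * walkVar b σ / 2| ≤ 1) (m : ℕ) :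
    ‖rangeAvg (b ^ m) (fun k => Complex.exp (((ξ * martWalk b σ m k : ℝ) : ℂ) * Complex.I)) -
      ((1 - ξ ^ 2 * walkVar b σ / 2 : ℝ) : ℂ) ^ m‖ ≤
      27 * |ξ| ^ 3 * m + ξ ^ 2 * (2 - 2 * (1 / 2) ^ m) := by
  induction m with
  | zero => simp [rangeAvg, martWalk_zero]
  | succ m ih =>
    have h := norm_rangeAvg_exp_martWalk_succ_sub_le hb hσ m hξ
    generalize rangeAvg (b ^ (m + 1)) (fun k => Complex.exp (((ξ * martWalk b σ (m + 1) k : ℝ) : ℂ) *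
        Complex.I)) = P' at *
    generalize rangeAvg (b ^ m) (fun k => Complex.exp (((ξ * martWalk b σ m k : ℝ) : ℂ) *
      Complex.I)) = P at *
    have ha : ‖((1 - ξ ^ 2 * walkVar b σ / 2 : ℝ) : ℂ)‖ ≤ 1 := by
      rwa [Complex.norm_real, Real.norm_eq_abs]
    generalize ((1 - ξ ^ 2 * walkVar b σ / 2 : ℝ) : ℂ) = a at *
    calc ‖P' - a ^ (m + 1)‖ = ‖(P' - a * P) + a * (P - a ^ m)‖ := by congr 1; ring
      _ ≤ ‖P' - a * P‖ + ‖a‖ * ‖P - a ^ m‖ := (norm_add_le _ _).trans_eq (by rw [norm_mul])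
      _ ≤ (27 * |ξ| ^ 3 + ξ ^ 2 * (1 / 2) ^ m) +
          (27 * |ξ| ^ 3 * m + ξ ^ 2 * (2 - 2 * (1 / 2) ^ m)) :=
        add_le_add h ((mul_le_of_le_one_left (norm_nonneg _) ha).trans ih)
      _ = _ := by push_cast; ring

theorem tendsto_rangeAvg_exp_martWalk {b : ℕ} (hb : 2 ≤ b) {σ : ℝ} (hσ : σ = 1 ∨ σ = -1) (u : ℝ) :
    Tendsto (fun m : ℕ => rangeAvg (b ^ m) (fun k =>
      Complex.exp (((u * (martWalk b σ m k / √m) : ℝ) : ℂ) * Complex.I))) atTop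
      (𝓝 (Complex.exp ((-(walkVar b σ * u ^ 2 / 2) : ℝ) : ℂ))) := by
  have hv0 := walkVar_nonneg hb hσ
  have hsqrt : Tendsto (fun m : ℕ => √(m : ℝ)) atTop atTop :=
    Real.tendsto_sqrt_atTop.comp tendsto_natCast_atTop_atTop
  have hξ : Tendsto (fun m : ℕ => u / √(m : ℝ)) atTop (𝓝 0) := hsqrt.const_div_atTop u
  have hpow : Tendsto (fun m : ℕ => ((1 - (u / √(m : ℝ)) ^ 2 * walkVar b σ / 2 : ℝ) : ℂ) ^ m) atTop
      (𝓝 (Complex.exp ((-(walkVar b σ * u ^ 2 / 2) : ℝ) : ℂ))) := by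
    have h := (Complex.continuous_ofReal.tendsto _).comp
      (Real.tendsto_one_add_div_pow_exp (-(walkVar b σ * u ^ 2 / 2)))
    rw [Complex.ofReal_exp] at h
    refine h.congr' (Eventually.of_forall fun m => ?_)
    simp only [Function.comp]
    push_cast
    congr 1
    have : ((√(m : ℝ) : ℝ) : ℂ) ^ 2 = m := by
      rw [← Complex.ofReal_pow, Real.sq_sqrt (Nat.cast_nonneg m)]; simp
    rw [div_pow, this]
    ring
  have herr : Tendsto (fun m : ℕ => 27 * |u| ^ 3 * (√(m : ℝ))⁻¹ + 2 * (u / √(m : ℝ)) ^ 2) atTop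
      (𝓝 0) := by
    have h := ((tendsto_inv_atTop_zero.comp hsqrt).const_mul (27 * |u| ^ 3)).add
      ((hξ.pow 2).const_mul 2)
    simpa using h
  have hev1 : ∀ᶠ m : ℕ in atTop, 3 * |u / √(m : ℝ)| ≤ 1 := by
    have h := hξ.abs.const_mul 3
    rw [abs_zero, mul_zero] at h
    exact h.eventually_le_const one_pos
  have hev2 : ∀ᶠ m : ℕ in atTop, |1 - (u / √(m : ℝ)) ^ 2 * walkVar b σ / 2| ≤ 1 := by
    have h : Tendsto (fun m : ℕ => (u / √(m : ℝ)) ^ 2 * walkVar b σ / 2) atTop (𝓝 0) := by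
      simpa using ((hξ.pow 2).mul_const (walkVar b σ)).div_const 2
    filter_upwards [h.eventually_le_const one_pos] with m hm
    have : 0 ≤ (u / √(m : ℝ)) ^ 2 * walkVar b σ / 2 := by positivity
    rw [abs_le]; constructor <;> linarith
  have hdiff : Tendsto (fun m : ℕ => rangeAvg (b ^ m) (fun k =>
      Complex.exp (((u * (martWalk b σ m k / √m) : ℝ) : ℂ) * Complex.I)) -
      ((1 - (u / √(m : ℝ)) ^ 2 * walkVar b σ / 2 : ℝ) : ℂ) ^ m) atTop (𝓝 0) := by
    refine squeeze_zero_norm' ?_ herr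
    filter_upwards [hev1, hev2, eventually_gt_atTop 0] with m h1 h2 hm
    have h := norm_rangeAvg_exp_martWalk_sub_pow_le hb hσ h1 h2 m
    have hm' : 0 < √(m : ℝ) := Real.sqrt_pos.2 (by exact_mod_cast hm)
    have e : ∀ k, u / √(m : ℝ) * martWalk b σ m k = u * (martWalk b σ m k / √m) := fun k => by ring
    simp only [e] at h
    refine h.trans (add_le_add (le_of_eq ?_) ?_)
    · have hs : (m : ℝ) = √(m : ℝ) ^ 2 := (Real.sq_sqrt (Nat.cast_nonneg m)).symm
      rw [abs_div, abs_of_pos hm']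
      nth_rewrite 2 [hs]
      field_simp
    · rw [mul_comm]
      refine mul_le_mul_of_nonneg_right ?_ (sq_nonneg _)
      have : (0 : ℝ) ≤ (1 / 2) ^ m := by positivity
      linarith
  simpa using hdiff.add hpow

/-! ### From weak convergence to first absolute moments -/

section weakConvergence

open MeasureTheory ProbabilityTheory

theorem integral_abs_gaussianReal {v : NNReal} (hv : v ≠ 0) :
    ∫ x, |x| ∂(gaussianReal 0 v) = √(2 * v / Real.pi) := by
  have hv' : (0 : ℝ) < v := by exact_mod_cast pos_iff_ne_zero.2 hv
  rw [integral_gaussianReal_eq_integral_smul hv]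
  have h1 : ∀ x : ℝ, gaussianPDFReal 0 v x • |x| =
      (fun y : ℝ => (√(2 * Real.pi * v))⁻¹ * (y ^ (1 : ℝ) *
        Real.exp (-(1 / (2 * v)) * y ^ (2 : ℝ)))) |x| := by
    intro x
    simp only [gaussianPDFReal, smul_eq_mul, sub_zero, Real.rpow_one, Real.rpow_two, sq_abs]
    rw [mul_assoc, mul_comm (Real.exp _)]
    congr 3
    ring
  simp_rw [h1]
  rw [integral_comp_abs (f := fun y : ℝ => (√(2 * Real.pi * v))⁻¹ * (y ^ (1 : ℝ) *
        Real.exp (-(1 / (2 * v)) * y ^ (2 : ℝ)))), integral_const_mul,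
    integral_rpow_mul_exp_neg_mul_rpow two_pos (by norm_num) (by positivity)]
  have h2 : √(2 * Real.pi * v) = √Real.pi * √(2 * v) := by
    rw [← Real.sqrt_mul Real.pi_pos.le]; congr 1; ring
  have h3 : √(2 * v / Real.pi) = √(2 * v) / √Real.pi := Real.sqrt_div (by positivity) _
  have h4 : √(2 * (v : ℝ)) ^ 2 = 2 * v := Real.sq_sqrt (by positivity)
  have h5 : 0 < √(2 * (v : ℝ)) := Real.sqrt_pos.2 (by positivity)
  have h6 : 0 < √Real.pi := Real.sqrt_pos.2 Real.pi_pos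
  have h7 : (1 / (2 * (v : ℝ))) ^ (-(1 + 1) / 2 : ℝ) = 2 * v := by
    rw [show (-(1 + 1) / 2 : ℝ) = -1 by norm_num, Real.rpow_neg_one, one_div, inv_inv]
  have h8 : Real.Gamma ((1 + 1) / 2) = 1 := by
    rw [show ((1 + 1) / 2 : ℝ) = 1 by norm_num, Real.Gamma_one]
  rw [h2, h3, h7, h8]
  field_simp
  linarith

/-- The uniform distribution on the values `g 0, …, g (N - 1)`. -/
noncomputable def empiricalMeasure (N : ℕ) (g : ℕ → ℝ) : Measure ℝ :=
  Measure.map (fun i : Fin N => g i) ((N : ENNReal)⁻¹ • Measure.count)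

theorem isProbabilityMeasure_empiricalMeasure {N : ℕ} (hN : 0 < N) (g : ℕ → ℝ) :
    IsProbabilityMeasure (empiricalMeasure N g) := by
  have : IsProbabilityMeasure ((N : ENNReal)⁻¹ • (Measure.count : Measure (Fin N))) := by
    constructor
    rw [Measure.smul_apply, Measure.count_univ, smul_eq_mul]
    simp only [ENat.card_eq_coe_fintype_card, Fintype.card_fin]
    exact ENNReal.inv_mul_cancel (by simpa using hN.ne') (by simp)
  exact Measure.isProbabilityMeasure_map (measurable_of_finite _).aemeasurable

theorem integral_empiricalMeasure {E : Type*} [NormedAddCommGroup E] [NormedSpace ℝ E]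
    [CompleteSpace E] (N : ℕ) (g : ℕ → ℝ) {F : ℝ → E} (hF : Continuous F) :
    ∫ x, F x ∂(empiricalMeasure N g) = rangeAvg N fun k => F (g k) := by
  rw [empiricalMeasure, integral_map (measurable_of_finite _).aemeasurable
    hF.aestronglyMeasurable, integral_smul_measure, integral_count, rangeAvg,
    Finset.sum_range fun k => F (g k)]
  simp

/-- If the characteristic functions of uniform distributions on finitely many values converge to
that of a centred Gaussian, and their second moments are bounded, then their first absolute moments
converge. -/
theorem tendsto_rangeAvg_abs {N : ℕ → ℕ} (hN : ∀ n, 0 < N n) {g : ℕ → ℕ → ℝ} {v C : ℝ}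
    (hv : 0 < v) (hC : ∀ n, rangeAvg (N n) (fun k => g n k ^ 2) ≤ C)
    (h : ∀ u : ℝ, Tendsto (fun n => rangeAvg (N n) fun k =>
      Complex.exp (((u * g n k : ℝ) : ℂ) * Complex.I)) atTop
      (𝓝 (Complex.exp ((-(v * u ^ 2 / 2) : ℝ) : ℂ)))) :
    Tendsto (fun n => rangeAvg (N n) fun k => |g n k|) atTop (𝓝 √(2 * v / Real.pi)) := by
  obtain ⟨w, rfl⟩ : ∃ w : NNReal, (w : ℝ) = v := ⟨⟨v, hv.le⟩, rfl⟩
  have hw : w ≠ 0 := by rintro rfl; simp at hv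
  have hweak : Tendsto (β := ProbabilityMeasure ℝ) (fun n => ⟨empiricalMeasure (N n) (g n),
      isProbabilityMeasure_empiricalMeasure (hN n) (g n)⟩) atTop
      (𝓝 ⟨gaussianReal 0 w, inferInstance⟩) := by
    refine ProbabilityMeasure.tendsto_iff_tendsto_charFun.2 fun u => ?_
    simp only [ProbabilityMeasure.coe_mk]
    rw [charFun_gaussianReal]
    convert! h u using 2
    · rw [charFun_apply_real, integral_empiricalMeasure _ _ (by fun_prop)]
      push_cast
      rfl
    · push_cast
      congr 1
      ring
  rw [← integral_abs_gaussianReal hw]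
  have hint2 : Integrable (fun x : ℝ => x ^ 2) (gaussianReal 0 w) :=
    (memLp_id_gaussianReal' 2 (by simp)).integrable_sq
  have hint1 : Integrable (fun x : ℝ => |x|) (gaussianReal 0 w) :=
    (memLp_one_iff_integrable.1 (memLp_id_gaussianReal' 1 (by simp))).abs
  set B : ℝ := ∫ x, x ^ 2 ∂(gaussianReal 0 w) with hB
  have hB0 : 0 ≤ B := integral_nonneg fun x => sq_nonneg x
  have hC0 : 0 ≤ C := by
    refine le_trans ?_ (hC 0)
    rw [rangeAvg]
    exact smul_nonneg (by positivity) (Finset.sum_nonneg fun _ _ => sq_nonneg _)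
  -- Truncating `|x|` at `K` costs at most `x² / K`, so second moments bound the tails uniformly in
  -- `n`.
  have htrunc : ∀ (K : ℝ) (_ : 0 < K) (x : ℝ), |x| - min |x| K ≤ K⁻¹ * x ^ 2 := by
    intro K hK x
    rcases le_total |x| K with hx | hx
    · rw [min_eq_left hx, sub_self]; positivity
    · rw [min_eq_right hx, ← sq_abs]
      have : |x| ≤ K⁻¹ * |x| ^ 2 := by
        rw [inv_mul_eq_div, le_div_iff₀ hK, sq]
        exact mul_le_mul_of_nonneg_left hx (abs_nonneg x)
      linarith
  rw [Metric.tendsto_atTop]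
  intro ε hε
  obtain ⟨K, hK0, hK⟩ : ∃ K : ℝ, 0 < K ∧ K⁻¹ * (B + C) < ε / 2 := by
    refine ⟨2 * (B + C + 1) / ε, by positivity, ?_⟩
    rw [inv_div, div_mul_eq_mul_div, div_lt_iff₀ (by positivity)]
    nlinarith
  let hbcf : BoundedContinuousFunction ℝ ℝ :=
    BoundedContinuousFunction.ofNormedAddCommGroup (fun x : ℝ => min |x| K)
      (by fun_prop) K (fun x => by
        rw [Real.norm_of_nonneg (le_min (abs_nonneg _) hK0.le)]; exact min_le_right _ _)
  have hlim := (ProbabilityMeasure.tendsto_iff_forall_integral_tendsto.1 hweak) hbcf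
  have hcoe : ∀ x, hbcf x = min |x| K := fun x => rfl
  simp only [ProbabilityMeasure.coe_mk, hcoe] at hlim
  obtain ⟨n₀, hn₀⟩ := Metric.tendsto_atTop.1 hlim (ε / 2) (by positivity)
  refine ⟨n₀, fun n hn => ?_⟩
  have hn := hn₀ n hn
  rw [integral_empiricalMeasure (N n) (g n) (F := fun x => min |x| K) (by fun_prop)] at hn
  have hint3 : Integrable (fun x : ℝ => min |x| K) (gaussianReal 0 w) := hbcf.integrable _
  have e1 : rangeAvg (N n) (fun k => |g n k|) - rangeAvg (N n) (fun k => min |g n k| K) ≤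
      K⁻¹ * C := by
    rw [← rangeAvg_sub]
    refine (rangeAvg_mono fun k _ => htrunc K hK0 (g n k)).trans ?_
    rw [rangeAvg_mul_left]
    exact mul_le_mul_of_nonneg_left (hC n) (by positivity)
  have e1' : rangeAvg (N n) (fun k => min |g n k| K) ≤ rangeAvg (N n) (fun k => |g n k|) :=
    rangeAvg_mono fun k _ => min_le_left _ _
  have e2 : ∫ x, |x| ∂(gaussianReal 0 w) - ∫ x, min |x| K ∂(gaussianReal 0 w) ≤ K⁻¹ * B := by
    rw [← integral_sub hint1 hint3, hB, ← integral_const_mul]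
    exact integral_mono (hint1.sub hint3) (hint2.const_mul _) fun x => htrunc K hK0 x
  have e2' : ∫ x, min |x| K ∂(gaussianReal 0 w) ≤ ∫ x, |x| ∂(gaussianReal 0 w) :=
    integral_mono hint3 hint1 fun x => min_le_left _ _
  rw [Real.dist_eq, abs_lt] at hn ⊢
  rw [mul_add] at hK
  have hKB : 0 ≤ K⁻¹ * B := by positivity
  have hKC : 0 ≤ K⁻¹ * C := by positivity
  constructor <;> linarith [hn.1, hn.2]

end weakConvergence

/-! ### Mean absolute value of the walk -/

theorem walkVar_pos {b : ℕ} (hb : 2 ≤ b) {σ : ℝ} (hσ : σ = 1 ∨ σ = -1) : 0 < walkVar b σ :=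
  div_pos (by linarith [(abs_le.1 (abs_stepCorr_le hb hσ)).1]) (stepCorr_lt_one hb hσ)

theorem tendsto_rangeAvg_abs_martWalk {b : ℕ} (hb : 2 ≤ b) {σ : ℝ} (hσ : σ = 1 ∨ σ = -1) :
    Tendsto (fun m : ℕ => rangeAvg (b ^ m) fun k => |martWalk b σ m k / √m|) atTop
      (𝓝 √(2 * walkVar b σ / Real.pi)) := by
  refine tendsto_rangeAvg_abs (C := 4) (fun m => pow_pos (by omega) m) (walkVar_pos hb hσ) ?_
    (tendsto_rangeAvg_exp_martWalk hb hσ)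
  intro m
  rcases Nat.eq_zero_or_pos m with rfl | hm
  · simp [rangeAvg, martWalk_zero]
  · have hm' : (0 : ℝ) < m := by exact_mod_cast hm
    have h := rangeAvg_martWalk_sq_le hb hσ m
    have e : ∀ k, (martWalk b σ m k / √m) ^ 2 = (m : ℝ)⁻¹ * martWalk b σ m k ^ 2 := fun k => by
      rw [div_pow, Real.sq_sqrt hm'.le]; ring
    simp only [e]
    rw [rangeAvg_mul_left, inv_mul_le_iff₀ hm']
    linarith

theorem tendsto_rangeAvg_abs_of_abs_sub_le {N : ℕ → ℕ} (hN : ∀ m, 0 < N m) {f g : ℕ → ℕ → ℝ}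
    {s : ℕ → ℝ} (hs : Tendsto s atTop atTop) {C L : ℝ}
    (hfg : ∀ m, ∀ k < N m, |f m k - g m k| ≤ C)
    (hg : Tendsto (fun m => rangeAvg (N m) (fun k => |g m k|) / s m) atTop (𝓝 L)) :
    Tendsto (fun m => rangeAvg (N m) (fun k => |f m k|) / s m) atTop (𝓝 L) := by
  have hdiff : Tendsto (fun m => rangeAvg (N m) (fun k => |f m k|) / s m -
      rangeAvg (N m) (fun k => |g m k|) / s m) atTop (𝓝 0) := by
    refine squeeze_zero_norm' ?_ (hs.const_div_atTop C)
    filter_upwards [hs.eventually_gt_atTop 0] with m hm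
    rw [← sub_div, ← rangeAvg_sub, norm_div, Real.norm_of_nonneg hm.le]
    refine div_le_div_of_nonneg_right ((norm_rangeAvg_le _ _).trans ?_) hm.le
    refine (rangeAvg_mono fun k hk => ?_).trans_eq (rangeAvg_const (hN m) C)
    exact (abs_abs_sub_abs_le_abs_sub _ _).trans (hfg m k hk)
  simpa using hdiff.add hg

theorem tendsto_rangeAvg_abs_signWalk {b : ℕ} (hb : 2 ≤ b) {σ : ℝ} (hσ : σ = 1 ∨ σ = -1) :
    Tendsto (fun m : ℕ => rangeAvg (b ^ m) (fun k => |signWalk b σ m k|) / √m) atTop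
      (𝓝 √(2 * walkVar b σ / Real.pi)) := by
  refine tendsto_rangeAvg_abs_of_abs_sub_le (C := 1) (g := martWalk b σ)
    (fun m => pow_pos (by omega) m) (Real.tendsto_sqrt_atTop.comp tendsto_natCast_atTop_atTop)
    (fun m k _ => ?_) ?_
  · rw [abs_sub_comm]; exact abs_martWalk_sub_signWalk_le hb hσ m k
  · refine (tendsto_rangeAvg_abs_martWalk hb hσ).congr fun m => ?_
    rw [div_eq_inv_mul, ← rangeAvg_mul_left]
    refine rangeAvg_congr fun k _ => ?_
    rw [abs_div, abs_of_nonneg (Real.sqrt_nonneg _), div_eq_inv_mul]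
    rfl

/-! ### The gauge and sums over one block -/

theorem criticalPhi_nonneg (x : ℝ) (hx : 0 ≤ x) : 0 ≤ criticalPhi x := by
  rw [criticalPhi]
  split_ifs
  · exact le_rfl
  · positivity

theorem log_natCast_lt_mul_log {b : ℕ} (hb : 2 ≤ b) {n : ℕ} (hn : 0 < n) :
    Real.log n < n * Real.log b := by
  rw [← Real.log_pow]
  refine Real.log_lt_log (by exact_mod_cast hn) ?_
  exact_mod_cast Nat.lt_pow_self (by omega)

theorem criticalPhi_div_pow_bounds {b : ℕ} (hb : 2 ≤ b) {n : ℕ} (hn : 0 < n) {s : ℝ}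
    (hs : s = 0 ∨ 1 ≤ s) (hsn : s ≤ n) :
    s / (b : ℝ) ^ n / √(n * Real.log b) ≤ criticalPhi (s / (b : ℝ) ^ n) ∧
      criticalPhi (s / (b : ℝ) ^ n) ≤ s / (b : ℝ) ^ n / √(n * Real.log b - Real.log n) := by
  have hb' : (0 : ℝ) < b := by exact_mod_cast (by omega : 0 < b)
  rcases hs with rfl | hs
  · simp [criticalPhi]
  · have hs0 : 0 < s := by linarith
    have hpos : 0 < s / (b : ℝ) ^ n := by positivity
    have hlog : -Real.log (s / (b : ℝ) ^ n) = n * Real.log b - Real.log s := by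
      rw [Real.log_div hs0.ne' (by positivity), Real.log_pow]; ring
    have h1 : Real.log s ≤ Real.log n := Real.log_le_log hs0 hsn
    have h2 : 0 ≤ Real.log s := Real.log_nonneg hs
    have h3 := log_natCast_lt_mul_log hb hn
    rw [criticalPhi, if_neg hpos.ne', hlog]
    constructor
    · exact div_le_div_of_nonneg_left hpos.le (Real.sqrt_pos.2 (by linarith))
        (Real.sqrt_le_sqrt (by linarith))
    · exact div_le_div_of_nonneg_left hpos.le (Real.sqrt_pos.2 (by linarith))
        (Real.sqrt_le_sqrt (by linarith))

/-- The values `δ = 0` and `δ = 1` give the lower and upper bounds for the gauge; neither `log` nor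
the shift `p` matters in the limit. -/
theorem tendsto_sqrt_div_sqrt_mul_log_sub {b : ℕ} (hb : 2 ≤ b) (p : ℕ) (δ : ℝ) :
    Tendsto (fun m : ℕ => √(m : ℝ) / √(((m + p : ℕ) : ℝ) * Real.log b - δ * Real.log (m + p : ℕ)))
      atTop (𝓝 (1 / √(Real.log b))) := by
  have hlb : 0 < Real.log b := Real.log_pos (by exact_mod_cast (by omega : 1 < b))
  have hcast : Tendsto (fun m : ℕ => ((m + p : ℕ) : ℝ)) atTop atTop :=
    tendsto_natCast_atTop_atTop.comp (tendsto_add_atTop_nat p)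
  have h1 : Tendsto (fun m : ℕ => ((m + p : ℕ) : ℝ) / m) atTop (𝓝 1) := by
    have h := (tendsto_const_div_atTop_nhds_zero_nat (p : ℝ)).const_add 1
    rw [add_zero] at h
    refine h.congr' ?_
    filter_upwards [eventually_gt_atTop 0] with m hm
    have : (m : ℝ) ≠ 0 := by exact_mod_cast hm.ne'
    push_cast; field_simp
  have h2 : Tendsto (fun m : ℕ => Real.log (m + p : ℕ) / ((m + p : ℕ) : ℝ)) atTop (𝓝 0) :=
    (Real.isLittleO_log_id_atTop.tendsto_div_nhds_zero).comp hcast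
  have h3 : Tendsto (fun m : ℕ => (((m + p : ℕ) : ℝ) * Real.log b - δ * Real.log (m + p : ℕ)) / m)
      atTop (𝓝 (Real.log b)) := by
    have h := h1.mul ((h2.const_mul δ).const_sub (Real.log b))
    rw [mul_zero, sub_zero, one_mul] at h
    refine h.congr' ?_
    filter_upwards [eventually_gt_atTop 0] with m hm
    have : (m : ℝ) ≠ 0 := by exact_mod_cast hm.ne'
    have : ((m + p : ℕ) : ℝ) ≠ 0 := by exact_mod_cast (by omega : m + p ≠ 0)
    field_simp
  have h4 := (h3.sqrt).inv₀ (Real.sqrt_pos.2 hlb).ne'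
  rw [one_div]
  refine h4.congr fun m => ?_
  rw [Real.sqrt_div' _ (Nat.cast_nonneg m), inv_div]

/-- The block is the `b`-adic interval of level `p` with index `a`. Its first `m` walk steps depend
only on `r`, and the other `p` steps are negligible against `√m`. -/
theorem tendsto_sum_criticalPhi_block {b : ℕ} (hb : 2 ≤ b) {σ : ℝ} (hσ : σ = 1 ∨ σ = -1)
    (p a : ℕ) :
    Tendsto (fun m : ℕ => ∑ r ∈ Finset.range (b ^ m),
      criticalPhi (adicIncrement b (takagiVdW b (σ / b)) (m + p) (a * b ^ m + r))) atTop
      (𝓝 (√(2 * walkVar b σ / Real.pi) / √(Real.log b) / (b : ℝ) ^ p)) := by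
  have hb0 : 0 < b := by omega
  have hb' : (0 : ℝ) < b := by exact_mod_cast hb0
  have hσ1 : |σ| = 1 := by rcases hσ with rfl | rfl <;> simp
  have hσ2 : σ ^ 2 = 1 := by rcases hσ with rfl | rfl <;> simp
  have hQ : Tendsto (fun m : ℕ => rangeAvg (b ^ m)
      (fun r => |signWalk b σ (m + p) (a * b ^ m + r)|) / √m) atTop
      (𝓝 √(2 * walkVar b σ / Real.pi)) := by
    refine tendsto_rangeAvg_abs_of_abs_sub_le (C := p) (g := signWalk b σ)
      (fun m => pow_pos hb0 m) (Real.tendsto_sqrt_atTop.comp tendsto_natCast_atTop_atTop)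
      (fun m r _ => ?_) (tendsto_rangeAvg_abs_signWalk hb hσ)
    rw [← signWalk_mul_pow_add b σ m a r]
    exact abs_signWalk_add_sub_le b hσ1 m p _
  have hlim : ∀ δ : ℝ, Tendsto (fun m : ℕ => ∑ r ∈ Finset.range (b ^ m),
      |signWalk b σ (m + p) (a * b ^ m + r)| / (b : ℝ) ^ (m + p) /
        √(((m + p : ℕ) : ℝ) * Real.log b - δ * Real.log (m + p : ℕ))) atTop
      (𝓝 (√(2 * walkVar b σ / Real.pi) / √(Real.log b) / (b : ℝ) ^ p)) := by
    intro δ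
    have h := (hQ.mul (tendsto_sqrt_div_sqrt_mul_log_sub hb p δ)).div_const ((b : ℝ) ^ p)
    rw [mul_one_div] at h
    refine h.congr' ?_
    filter_upwards [eventually_gt_atTop 0] with m hm
    have hm' : √(m : ℝ) ≠ 0 := (Real.sqrt_pos.2 (by exact_mod_cast hm)).ne'
    rw [div_mul_div_cancel₀ hm', ← Finset.sum_div, ← Finset.sum_div, rangeAvg, smul_eq_mul, pow_add]
    push_cast
    field_simp
  have hbd : ∀ m r : ℕ, 0 < m →
      |signWalk b σ (m + p) (a * b ^ m + r)| / (b : ℝ) ^ (m + p) /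
          √(((m + p : ℕ) : ℝ) * Real.log b - 0 * Real.log (m + p : ℕ)) ≤
        criticalPhi (adicIncrement b (takagiVdW b (σ / b)) (m + p) (a * b ^ m + r)) ∧
      criticalPhi (adicIncrement b (takagiVdW b (σ / b)) (m + p) (a * b ^ m + r)) ≤
        |signWalk b σ (m + p) (a * b ^ m + r)| / (b : ℝ) ^ (m + p) /
          √(((m + p : ℕ) : ℝ) * Real.log b - 1 * Real.log (m + p : ℕ)) := by
    intro m r hm
    rw [zero_mul, sub_zero, one_mul, adicIncrement_takagiVdW hb0 hσ2]
    refine criticalPhi_div_pow_bounds hb (by omega) ?_ (abs_signWalk_le b hσ1 _ _)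
    obtain ⟨z, hz⟩ := exists_int_signWalk b hσ (m + p) (a * b ^ m + r)
    rw [hz]
    rcases eq_or_ne z 0 with rfl | hz0
    · simp
    · exact Or.inr (by exact_mod_cast Int.one_le_abs hz0)
  refine tendsto_of_tendsto_of_tendsto_of_le_of_le' (hlim 0) (hlim 1) ?_ ?_
  · filter_upwards [eventually_gt_atTop 0] with m hm
    exact Finset.sum_le_sum fun r _ => (hbd m r hm).1
  · filter_upwards [eventually_gt_atTop 0] with m hm
    exact Finset.sum_le_sum fun r _ => (hbd m r hm).2

/-! ### Variation on `[0, t]` -/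

theorem hasPhiVariation_takagiVdW {b : ℕ} (hb : 2 ≤ b) {σ : ℝ} (hσ : σ = 1 ∨ σ = -1) {t : ℝ}
    (ht : 0 ≤ t) :
    HasPhiVariation criticalPhi b (takagiVdW b (σ / b)) t
      (t * (√(2 * walkVar b σ / Real.pi) / √(Real.log b))) := by
  have hb0 : 0 < b := by omega
  have hb' : (0 : ℝ) < b := by exact_mod_cast hb0
  have hσ1 : |σ| = 1 := by rcases hσ with rfl | rfl <;> simp
  have hσ2 : σ ^ 2 = 1 := by rcases hσ with rfl | rfl <;> simp
  refine ⟨Eventually.of_forall fun n k _ => ?_, ?_⟩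
  · rw [adicIncrement_takagiVdW hb0 hσ2, div_lt_one (by positivity)]
    refine (abs_signWalk_le b hσ1 n k).trans_lt ?_
    exact_mod_cast Nat.lt_pow_self (by omega)
  · obtain ⟨L, hL⟩ : ∃ L, L = √(2 * walkVar b σ / Real.pi) / √(Real.log b) := ⟨_, rfl⟩
    have hL0 : 0 ≤ L := by rw [hL]; positivity
    rw [← hL]
    have hblocks : ∀ p a : ℕ, Tendsto (fun m : ℕ => ∑ k ∈ Finset.range (a * b ^ m),
        criticalPhi (adicIncrement b (takagiVdW b (σ / b)) (m + p) k)) atTop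
        (𝓝 (a * (L / (b : ℝ) ^ p))) := by
      intro p a
      have h := tendsto_finsetSum (Finset.range a) fun i _ =>
        tendsto_sum_criticalPhi_block hb hσ p i
      rw [← hL, Finset.sum_const, Finset.card_range, nsmul_eq_mul] at h
      exact h.congr fun m => (sum_range_mul_eq _ _ _).symm
    have hnonneg : ∀ n k, 0 ≤ criticalPhi (adicIncrement b (takagiVdW b (σ / b)) n k) :=
      fun n k => criticalPhi_nonneg _ (abs_nonneg _)
    have hsmall : ∀ ε > 0, ∃ p : ℕ, L / (b : ℝ) ^ p < ε := by
      intro ε hε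
      have h : Tendsto (fun p : ℕ => L / (b : ℝ) ^ p) atTop (𝓝 0) :=
        (tendsto_pow_atTop_atTop_of_one_lt (by exact_mod_cast (by omega : 1 < b))).const_div_atTop L
      exact (h.eventually_lt_const hε).exists
    have hpow : ∀ m p : ℕ, t * (b : ℝ) ^ (m + p) = t * (b : ℝ) ^ p * (b : ℝ) ^ m := fun m p => by
      rw [pow_add]; ring
    have hshift : ∀ (p : ℕ) (P : ℕ → Prop), (∀ᶠ m in atTop, P (m + p)) → ∀ᶠ n in atTop, P n := by
      intro p P h
      rwa [← map_add_atTop_eq_nat p, eventually_map]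
    -- For fixed `p`, the sum lies between those over `⌊t bᵖ⌋` and `⌊t bᵖ⌋ + 1` full blocks, whose
    -- limits differ by `L / bᵖ`. The extra index `k = ⌊t bⁿ⌋` still falls within the larger range.
    refine tendsto_order.2 ⟨fun c hc => ?_, fun c hc => ?_⟩
    · obtain ⟨p, hp⟩ := hsmall (t * L - c) (by linarith)
      have hfl : t * (b : ℝ) ^ p < ⌊t * (b : ℝ) ^ p⌋₊ + 1 := Nat.lt_floor_add_one _
      have hval : c < (⌊t * (b : ℝ) ^ p⌋₊ : ℝ) * (L / (b : ℝ) ^ p) := by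
        have h1 : t * L = t * (b : ℝ) ^ p * (L / (b : ℝ) ^ p) := by field_simp
        have h2 : 0 ≤ L / (b : ℝ) ^ p := by positivity
        nlinarith [mul_le_mul_of_nonneg_right hfl.le h2]
      refine hshift p _ ?_
      filter_upwards [(hblocks p _).eventually_const_lt hval] with m hm
      refine hm.trans_le (Finset.sum_le_sum_of_subset_of_nonneg ?_ fun k _ _ => hnonneg _ _)
      refine Finset.range_subset_range.2 ((Nat.le_floor ?_).trans (Nat.le_succ _))
      push_cast
      rw [hpow]
      exact mul_le_mul_of_nonneg_right (Nat.floor_le (by positivity)) (by positivity)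
    · obtain ⟨p, hp⟩ := hsmall (c - t * L) (by linarith)
      have hfl : (⌊t * (b : ℝ) ^ p⌋₊ : ℝ) ≤ t * (b : ℝ) ^ p := Nat.floor_le (by positivity)
      have hval : ((⌊t * (b : ℝ) ^ p⌋₊ + 1 : ℕ) : ℝ) * (L / (b : ℝ) ^ p) < c := by
        have h1 : t * L = t * (b : ℝ) ^ p * (L / (b : ℝ) ^ p) := by field_simp
        have h2 : 0 ≤ L / (b : ℝ) ^ p := by positivity
        push_cast
        nlinarith [mul_le_mul_of_nonneg_right hfl h2]
      refine hshift p _ ?_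
      filter_upwards [(hblocks p _).eventually_lt_const hval] with m hm
      refine lt_of_le_of_lt
        (Finset.sum_le_sum_of_subset_of_nonneg ?_ fun k _ _ => hnonneg _ _) hm
      refine Finset.range_subset_range.2 (Nat.succ_le_of_lt ((Nat.floor_lt (by positivity)).2 ?_))
      push_cast
      rw [hpow]
      exact mul_lt_mul_of_pos_right (Nat.lt_floor_add_one _) (by positivity)

theorem theorem1 (b : ℕ) (hb : 2 ≤ b) (α : ℝ) (hα : |α| = 1 / (b : ℝ)) :
    (Even b → ∀ t ∈ Set.Icc (0 : ℝ) 1,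
      HasPhiVariation criticalPhi b (takagiVdW b α) t
        (t * √(2 / (Real.pi * Real.log b)))) ∧
    (Odd b → ∀ t ∈ Set.Icc (0 : ℝ) 1,
      HasPhiVariation criticalPhi b (takagiVdW b α) t
        (t * √(2 * ((b : ℝ) + Real.sign α) /
          (Real.pi * ((b : ℝ) - Real.sign α) * Real.log b)))) := by
  have hb' : (2 : ℝ) ≤ b := by exact_mod_cast hb
  have hα0 : α ≠ 0 := by
    rintro rfl
    have : (0 : ℝ) < 1 / b := by positivity
    simp at hα
    linarith
  have hσ : Real.sign α = 1 ∨ Real.sign α = -1 := (Real.sign_apply_eq_of_ne_zero α hα0).symm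
  have hασ : α = Real.sign α / b := by
    rw [← mul_one_div, ← hα]
    rcases lt_or_gt_of_ne hα0 with h | h
    · rw [Real.sign_of_neg h, abs_of_neg h]; ring
    · rw [Real.sign_of_pos h, abs_of_pos h]; ring
  have key := fun (t : ℝ) (ht : 0 ≤ t) => hasPhiVariation_takagiVdW hb hσ ht
  rw [← hασ] at key
  have hlim : √(2 * walkVar b (Real.sign α) / Real.pi) / √(Real.log b) =
      √(2 * walkVar b (Real.sign α) / Real.pi / Real.log b) :=
    (Real.sqrt_div (by have := walkVar_nonneg hb hσ; positivity) _).symm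
  rw [hlim] at key
  constructor
  · intro he t ht
    -- For even `b` there is no middle digit: the correlation is zero and the variance is one.
    have hv : walkVar b (Real.sign α) = 1 := by
      simp [walkVar, stepCorr, midRatio, Nat.even_iff.1 he]
    have h := key t ht.1
    rwa [hv, mul_one, div_div] at h
  · intro ho t ht
    have hne : (b : ℝ) - Real.sign α ≠ 0 := by
      rcases hσ with h | h <;> rw [h] <;> linarith
    have hv : walkVar b (Real.sign α) = ((b : ℝ) + Real.sign α) / (b - Real.sign α) := by
      rw [walkVar, stepCorr, midRatio, Nat.odd_iff.1 ho]
      have hb0 : (b : ℝ) ≠ 0 := by positivity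
      have hne' : 1 - ((1 : ℕ) : ℝ) / b * Real.sign α ≠ 0 := by
        intro h
        apply hne
        field_simp at h
        push_cast at h
        linarith
      rw [div_eq_div_iff hne' hne]
      field_simp
      push_cast
      ring
    have h := key t ht.1
    have e : 2 * walkVar b (Real.sign α) / Real.pi / Real.log b =
        2 * ((b : ℝ) + Real.sign α) / (Real.pi * ((b : ℝ) - Real.sign α) * Real.log b) := by
      rw [hv, div_div, mul_div_assoc', div_div]
      congr 1
      ring
    rwa [e] at h
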